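/- Consider the discrete-time linear system $\mathbf{x}_{k+1}=A\mathbf{x}_k+B\mathbf{w}_k$, $\mathbf{y}_k=C\mathbf{x}_k+\mathbf{v}_k$ ($k\in\mathbb{N}_0$), with $A\in\mathbb{R}^{n\times n}$ nonsingular, $B\in\mathbb{R}^{n\times p}$, $C\in\mathbb{R}^{m\times n}$. Here $\mathbf{x}_0,\mathbf{w}_k,\mathbf{v}_k$ are uncertain variables, i.e. maps on a non-empty sample space $\Omega$; the range $[\![\mathbf{z}]\!]$ of an uncertain variable $\mathbf{z}$ is the set of its values, and the conditional range $[\![\mathbf{z}|y]\!]$ is the set of the values $\mathbf{z}(\omega)$ over all $\omega$ with $\mathbf{y}(\omega)=y$. Assume that $[\![\mathbf{x}_0]\!]$ is bounded, that the diameters of $[\![\mathbf{w}_k]\!]$ and of $[\![\mathbf{v}_k]\!]$ are bounded by constants $d_w$ and $d_v$ for all $k$, and that for every $k$ the variables $\mathbf{w}_0,\dots,\mathbf{w}_k,\mathbf{v}_0,\dots,\mathbf{v}_k,\mathbf{x}_0$ are unrelated (their joint range is the product of their ranges). Let $\hat X_0\subset\mathbb{R}^n$ be a bounded set (the initial condition).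 For an observed measurement sequence $y_0,y_1,\dots$ (one with $(y_0,\dots,y_k)\in[\![(\mathbf{y}_0,\dots,\mathbf{y}_k)]\!]$ for all $k$), the classical linear set-membership filter computes the estimates $$Z_0=\mathcal{X}_0\cap\hat X_0,\qquad Z_{k+1}=\mathcal{X}_{k+1}\cap\big(AZ_k+B[\![\mathbf{w}_k]\!]\big),\qquad \mathcal{X}_k=\{x\in\mathbb{R}^n:\ y_k=Cx+v\text{ for some }v\in[\![\mathbf{v}_k]\!]\},$$ where $+$ is the Minkowski sum. Let $P\in\mathbb{R}^{n\times n}$ be a nonsingular matrix giving an observability decomposition of $(A,C)$, that is, with $n=n_o+n_{\bar o}$, $$PAP^{-1}=\begin{bmatrix}\tilde A_o&0\\ \tilde A_{21}&\tilde A_{\bar o}\end{bmatrix},\qquad CP^{-1}=\begin{bmatrix}\tilde C_o&0\end{bmatrix},\qquad(\tilde A_o,\tilde C_o)\text{ observable},$$ and let $\pi_o(x)\in\mathbb{R}^{n_o}$ be the vector of the first $n_o$ coordinates of $Px$. Suppose that (i) $\pi_o(\hat X_0)\supseteq\pi_o([\![\mathbf{x}_0]\!])$; (ii) the pair $(A,C)$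 is detectable, i.e. there is a matrix $L$ such that all eigenvalues of $A-LC$ have modulus less than $1$. Then the filter is stable: for every observed measurement sequence, $Z_k\neq\emptyset$ for all $k\in\mathbb{N}_0$, and there is a constant $\bar d>0$, depending neither on $k$ nor on the observed measurement sequence, such that the Hausdorff distance (for the Euclidean norm) between $Z_k$ and the true conditional range $[\![\mathbf{x}_k|y_0,\dots,y_k]\!]$ is at most $\bar d$ for all $k\in\mathbb{N}_0$. -/

import Mathlib

/-- The Euclidean space of dimension `n`. -/
abbrev Euc (n : ℕ) : Type := EuclideanSpace ℝ (Fin n)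

/-- The matrix `M` applied to a vector of a Euclidean space. -/
noncomputable def mulE {m n : ℕ} (M : Matrix (Fin m) (Fin n) ℝ) (x : Euc n) : Euc m :=
  WithLp.toLp 2 (M.mulVec (WithLp.ofLp x))

section UncertainVariables

/-- An uncertain variable is a map `X` on a sample space `Ω`; its range. -/
def ucRange {Ω α : Type*} (X : Ω → α) : Set α := Set.range X

/-- The conditional range of the uncertain variable `X` given the realization `y` of `Y`. -/
def condRange {Ω α β : Type*} (X : Ω → α) (Y : Ω → β) (y : β) : Set α :=
  X '' {ω | Y ω = y}

/-- The tuple `Z₀, …, Z_k` of the first `k + 1` uncertain variables of a sequence. -/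
def upTo {Ω α : Type*} (Z : ℕ → Ω → α) (k : ℕ) (ω : Ω) : Fin (k + 1) → α :=
  fun i => Z i ω

end UncertainVariables

/-- The data of a linear system described by uncertain variables on the sample space `Ω`:
`x_{k+1} = A x_k + B w_k` and `y_k = C x_k + v_k`, with initial state `x0`, process noises `w`
and measurement noises `v`. -/
structure UncertainSystem (Ω : Type*) (n p m : ℕ) where
  /-- state matrix -/
  A : Matrix (Fin n) (Fin n) ℝ
  /-- input matrix of the process noise -/
  B : Matrix (Fin n) (Fin p) ℝ
  /-- measurement matrix -/
  C : Matrix (Fin m) (Fin n) ℝ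
  /-- initial state -/
  x0 : Ω → Euc n
  /-- process noises -/
  w : ℕ → Ω → Euc p
  /-- measurement noises -/
  v : ℕ → Ω → Euc m

namespace UncertainSystem

variable {Ω : Type*} {n p m : ℕ}

/-- The state `x_k`. -/
noncomputable def state (S : UncertainSystem Ω n p m) : ℕ → Ω → Euc n
  | 0 => S.x0
  | k + 1 => fun ω => mulE S.A (state S k ω) + mulE S.B (S.w k ω)

/-- The measurement `y_k`. -/
noncomputable def meas (S : UncertainSystem Ω n p m) (k : ℕ) (ω : Ω) : Euc m :=
  mulE S.C (S.state k ω) + S.v k ω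

/-- For every `k`, the uncertain variables `w_0, …, w_k, v_0, …, v_k, x_0` are unrelated: their
joint range is the Cartesian product of their ranges. -/
def Unrelated (S : UncertainSystem Ω n p m) : Prop :=
  ∀ k : ℕ,
    ucRange (fun ω => (upTo S.w k ω, upTo S.v k ω, S.x0 ω)) =
      (Set.univ.pi fun i : Fin (k + 1) => ucRange (S.w i)) ×ˢ
        ((Set.univ.pi fun i : Fin (k + 1) => ucRange (S.v i)) ×ˢ ucRange S.x0)

/-- `y` is a sequence of observed measurements: for every `k`, the tuple `y_0, …, y_k` is a
realization of the first `k + 1` measurements. -/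
def IsObserved (S : UncertainSystem Ω n p m) (y : ℕ → Euc m) : Prop :=
  ∀ k : ℕ, (fun i : Fin (k + 1) => y i) ∈ ucRange (upTo S.meas k)

/-- The true conditional range of `x_k` given the observed measurements `y_0, …, y_k`. -/
def trueRange (S : UncertainSystem Ω n p m) (y : ℕ → Euc m) (k : ℕ) : Set (Euc n) :=
  condRange (S.state k) (upTo S.meas k) (fun i : Fin (k + 1) => y i)

/-- The set of the states that are consistent with the measurement `y` when the measurement noise
has range `V`. -/
def solutionSet (C : Matrix (Fin m) (Fin n) ℝ) (y : Euc m) (V : Set (Euc m)) : Set (Euc n) :=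
  {x | ∃ v ∈ V, y = mulE C x + v}

open scoped Pointwise in
/-- Prediction step: the Minkowski sum `A S + B W`. -/
def predict (A : Matrix (Fin n) (Fin n) ℝ) (B : Matrix (Fin n) (Fin p) ℝ)
    (W : Set (Euc p)) (T : Set (Euc n)) : Set (Euc n) :=
  mulE A '' T + mulE B '' W

/-- The classical linear set-membership filtering recursion with initial condition `X̂₀`: the
estimate at time `k` from the measurements `y_0, …, y_k`. -/
def classicalSMF (S : UncertainSystem Ω n p m) (Xhat0 : Set (Euc n)) (y : ℕ → Euc m) :
    ℕ → Set (Euc n)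
  | 0 => solutionSet S.C (y 0) (ucRange (S.v 0)) ∩ Xhat0
  | k + 1 => solutionSet S.C (y (k + 1)) (ucRange (S.v (k + 1))) ∩
      predict S.A S.B (ucRange (S.w k)) (classicalSMF S Xhat0 y k)

/-- A filter, which returns the estimate `Z y k` at time `k` for the measurements `y`, is
well-posed if its estimates are never empty. -/
def WellPosed (S : UncertainSystem Ω n p m) (Z : (ℕ → Euc m) → ℕ → Set (Euc n)) : Prop :=
  ∀ y, S.IsObserved y → ∀ k, (Z y k).Nonempty

/-- The estimation gap of a filter, i.e. the Hausdorff distance (with values in `[0, ∞]`) between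
the estimate and the true conditional range, is bounded. The bound depends neither on the time
nor on the observed measurements. -/
def BoundedGap (S : UncertainSystem Ω n p m) (Z : (ℕ → Euc m) → ℕ → Set (Euc n)) : Prop :=
  ∃ d : ℝ, 0 < d ∧ ∀ y, S.IsObserved y → ∀ k,
    Metric.hausdorffEDist (Z y k) (S.trueRange y k) ≤ ENNReal.ofReal d

/-- Stability of a filter. -/
def StableFilter (S : UncertainSystem Ω n p m) (Z : (ℕ → Euc m) → ℕ → Set (Euc n)) : Prop :=
  S.WellPosed Z ∧ S.BoundedGap Z

end UncertainSystem

section SystemTheory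

variable {n m no nu : ℕ}

/-- `(A, C)` is observable: the observability matrix with block rows `C, C A, …, C A^(n-1)` has
rank `n`. -/
def ObservablePair (A : Matrix (Fin n) (Fin n) ℝ) (C : Matrix (Fin m) (Fin n) ℝ) : Prop :=
  (Matrix.of fun (r : Fin n × Fin m) (j : Fin n) => (C * A ^ (r.1 : ℕ)) r.2 j).rank = n

/-- `(A, C)` is detectable (in discrete time): there is an output injection gain `L` such that
all complex eigenvalues of `A - L C` have modulus less than one. -/
def DetectablePair (A : Matrix (Fin n) (Fin n) ℝ) (C : Matrix (Fin m) (Fin n) ℝ) : Prop :=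
  ∃ L : Matrix (Fin n) (Fin m) ℝ,
    spectralRadius ℂ ((A - L * C).map (algebraMap ℝ ℂ)) < 1

/-- For `n = no + nu`, the splitting of the `n` coordinates into the first `no` ones and the last
`nu` ones. -/
def splitIndex (hn : no + nu = n) : Fin no ⊕ Fin nu ≃ Fin n :=
  finSumFinEquiv.trans (finCongr hn)

/-- The nonsingular matrix `P` transforms `(A, C)` into the observability decomposition: in the
coordinates `P x`, the state matrix is `[Ao, 0; A21, Au]` and the measurement matrix is `[Co, 0]`,
where `(Ao, Co)` is observable. -/
def IsObservabilityDecomposition (A : Matrix (Fin n) (Fin n) ℝ) (C : Matrix (Fin m) (Fin n) ℝ)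
    (hn : no + nu = n) (P : Matrix (Fin n) (Fin n) ℝ) : Prop :=
  IsUnit P.det ∧
  ∃ (Ao : Matrix (Fin no) (Fin no) ℝ) (A21 : Matrix (Fin nu) (Fin no) ℝ)
    (Au : Matrix (Fin nu) (Fin nu) ℝ) (Co : Matrix (Fin m) (Fin no) ℝ),
    (P * A * P⁻¹).submatrix (splitIndex hn) (splitIndex hn) = Matrix.fromBlocks Ao 0 A21 Au ∧
    (C * P⁻¹).submatrix id (splitIndex hn) = Matrix.fromCols Co 0 ∧
    ObservablePair Ao Co

/-- The observable part of the state `x`: the first `no` coordinates of `P x`. -/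
noncomputable def obsPart (hn : no + nu = n) (P : Matrix (Fin n) (Fin n) ℝ) (x : Euc n) :
    Euc no :=
  WithLp.toLp 2 fun i => mulE P x (splitIndex hn (Sum.inl i))

end SystemTheory

/-! The two halves of stability have separate causes. Nonemptiness: the kernel of `obsPart` is
invariant under `A` and contained in the kernel of `C`. Condition (i) provides a point of the
initial condition with the observable part of the true initial state. Driven by the same process
noise, its trajectory differs from the true one only inside this kernel, so the same measurement
noise explains the data and the point survives every intersection
(`exists_mem_classicalSMF_of_obsPart`). Bounded gap: if `e` is the difference between a point of the
estimate and a state compatible with the same measurements, then `C e` is a difference of two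
measurement noises. Hence `A e` equals `(A - L C) e` plus a bounded term, and the error is the
response of a Schur stable matrix to bounded data (`exists_error_eq_response`,
`exists_norm_response_le`). Every pair of points is thus uniformly close, which is more than a
Hausdorff bound between nonempty sets. -/

section MulE

variable {l m n : ℕ}

lemma mulE_add (M : Matrix (Fin m) (Fin n) ℝ) (x y : Euc n) :
    mulE M (x + y) = mulE M x + mulE M y := by
  simp [mulE, Matrix.mulVec_add]

lemma mulE_sub (M : Matrix (Fin m) (Fin n) ℝ) (x y : Euc n) :
    mulE M (x - y) = mulE M x - mulE M y := by
  simp [mulE, Matrix.mulVec_sub]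

lemma mulE_sum {ι : Type*} (M : Matrix (Fin m) (Fin n) ℝ) (s : Finset ι) (f : ι → Euc n) :
    mulE M (∑ i ∈ s, f i) = ∑ i ∈ s, mulE M (f i) :=
  map_sum (AddMonoidHom.mk' (mulE M) (mulE_add M)) f s

lemma sub_mulE (M N : Matrix (Fin m) (Fin n) ℝ) (x : Euc n) :
    mulE (M - N) x = mulE M x - mulE N x := by
  simp [mulE, Matrix.sub_mulVec]

lemma mulE_mulE (M : Matrix (Fin l) (Fin m) ℝ) (N : Matrix (Fin m) (Fin n) ℝ) (x : Euc n) :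
    mulE M (mulE N x) = mulE (M * N) x := by
  simp [mulE, Matrix.mulVec_mulVec]

lemma one_mulE (x : Euc n) : mulE 1 x = x := by
  simp [mulE]

open scoped Matrix.Norms.L2Operator in
lemma norm_mulE_le (M : Matrix (Fin m) (Fin n) ℝ) (x : Euc n) : ‖mulE M x‖ ≤ ‖M‖ * ‖x‖ :=
  Matrix.l2_opNorm_mulVec M x

-- Detectability is a statement about complex eigenvalues, so the decay of powers is known for the
-- complexified matrix. Embedding real vectors in the complex space is isometric and commutes with
-- the matrix action, which brings the bound back.
open scoped Matrix.Norms.L2Operator in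
lemma norm_mulE_le_map_complex (M : Matrix (Fin m) (Fin n) ℝ) (x : Euc n) :
    ‖mulE M x‖ ≤ ‖M.map (algebraMap ℝ ℂ)‖ * ‖x‖ := by
  have h := Matrix.l2_opNorm_mulVec (M.map (algebraMap ℝ ℂ))
    (WithLp.toLp 2 fun i => (algebraMap ℝ ℂ) (x i))
  have hx : ‖(WithLp.toLp 2 fun i => (algebraMap ℝ ℂ) (x i) : EuclideanSpace ℂ (Fin n))‖ = ‖x‖ := by
    simp [EuclideanSpace.norm_eq]
  have hM : ‖(WithLp.toLp 2 ((M.map (algebraMap ℝ ℂ)).mulVec fun i => (algebraMap ℝ ℂ) (x i)) :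
      EuclideanSpace ℂ (Fin m))‖ = ‖mulE M x‖ := by
    have (i : Fin m) : (M.map (algebraMap ℝ ℂ)).mulVec (fun i => (algebraMap ℝ ℂ) (x i)) i =
        (algebraMap ℝ ℂ) (mulE M x i) :=
      ((algebraMap ℝ ℂ).map_mulVec M x i).symm
    simp only [EuclideanSpace.norm_eq, this, norm_algebraMap']
  rw [← hM, ← hx]
  exact h

end MulE

/-! ### Schur stability and bounded responses -/

/-- The powers of an element of spectral radius less than one are summable in norm. -/
lemma summable_norm_pow_of_spectralRadius_lt_one {R : Type*} [NormedRing R] [NormedAlgebra ℂ R]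
    [CompleteSpace R] {a : R} (ha : spectralRadius ℂ a < 1) : Summable fun k : ℕ => ‖a ^ k‖ := by
  obtain ⟨r, har, hr⟩ := ENNReal.lt_iff_exists_nnreal_btwn.1 ha
  have hr1 : (r : ℝ) < 1 := by exact_mod_cast hr
  refine (summable_geometric_of_lt_one r.coe_nonneg hr1).of_norm_bounded_eventually_nat ?_
  -- Gelfand's formula: eventually the `k`-th root of `‖a ^ k‖` is below `r`. Raising to the power
  -- `k` needs `k ≠ 0` to cancel the exponents.
  filter_upwards [(spectrum.pow_nnnorm_pow_one_div_tendsto_nhds_spectralRadius a).eventually_lt_const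
    har, Filter.eventually_gt_atTop 0] with k hk hk0
  have h : ((‖a ^ k‖₊ : ENNReal) ^ (1 / (k : ℝ))) ^ (k : ℝ) ≤ (r : ENNReal) ^ (k : ℝ) :=
    ENNReal.rpow_le_rpow hk.le k.cast_nonneg
  rw [← ENNReal.rpow_mul, one_div_mul_cancel (by positivity), ENNReal.rpow_one,
    ENNReal.rpow_natCast] at h
  rw [norm_norm]
  exact_mod_cast h

/-- A Schur stable matrix has a bounded response to bounded initial states and inputs. -/
lemma exists_norm_response_le {n : ℕ} (M : Matrix (Fin n) (Fin n) ℝ)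
    (hM : spectralRadius ℂ (M.map (algebraMap ℝ ℂ)) < 1) {R D : ℝ} (hR : 0 ≤ R) (hD : 0 ≤ D) :
    ∃ d : ℝ, 0 < d ∧ ∀ (k : ℕ) (e : Euc n) (u : ℕ → Euc n), ‖e‖ ≤ R → (∀ i, ‖u i‖ ≤ D) →
      ‖mulE (M ^ k) e + ∑ i ∈ Finset.range k, mulE (M ^ i) (u i)‖ ≤ d := by
  open scoped Matrix.Norms.L2Operator in
  have : CompleteSpace (Matrix (Fin n) (Fin n) ℂ) := FiniteDimensional.complete ℂ _
  have hs : Summable fun k : ℕ => ‖M.map (algebraMap ℝ ℂ) ^ k‖ :=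
    summable_norm_pow_of_spectralRadius_lt_one hM
  set s : ℝ := ∑' k, ‖M.map (algebraMap ℝ ℂ) ^ k‖
  have hs0 : 0 ≤ s := tsum_nonneg fun _ => norm_nonneg _
  have hpow (i : ℕ) (x : Euc n) : ‖mulE (M ^ i) x‖ ≤ ‖M.map (algebraMap ℝ ℂ) ^ i‖ * ‖x‖ := by
    rw [← Matrix.map_pow]
    exact norm_mulE_le_map_complex _ _
  -- The sum `s` dominates each single power as well as every partial sum; the `1` only makes the
  -- bound strictly positive.
  refine ⟨s * R + s * D + 1, by positivity, fun k e u he hu => ?_⟩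
  have h1 : ‖mulE (M ^ k) e‖ ≤ s * R := (hpow k e).trans <|
    mul_le_mul (hs.le_tsum k fun _ _ => norm_nonneg _) he (norm_nonneg _) hs0
  have h2 : ‖∑ i ∈ Finset.range k, mulE (M ^ i) (u i)‖ ≤ s * D := calc
    _ ≤ ∑ i ∈ Finset.range k, ‖M.map (algebraMap ℝ ℂ) ^ i‖ * D :=
      norm_sum_le_of_le _ fun i _ => (hpow i _).trans <|
        mul_le_mul_of_nonneg_left (hu i) (norm_nonneg _)
    _ ≤ s * D := by
      rw [← Finset.sum_mul]
      exact mul_le_mul_of_nonneg_right (hs.sum_le_tsum _ fun _ _ => norm_nonneg _) hD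
  linarith [norm_add_le (mulE (M ^ k) e) (∑ i ∈ Finset.range k, mulE (M ^ i) (u i))]

lemma norm_sub_le_of_ediam_le {E : Type*} [SeminormedAddCommGroup E] {T : Set E} {d : ℝ}
    (hd : 0 ≤ d) (hT : Metric.ediam T ≤ ENNReal.ofReal d) {a b : E} (ha : a ∈ T) (hb : b ∈ T) :
    ‖a - b‖ ≤ d := by
  have h := (Metric.edist_le_ediam_of_mem ha hb).trans hT
  rwa [edist_le_ofReal hd, dist_eq_norm] at h

/-- Nonempty sets whose points are pairwise at distance at most `d` are at Hausdorff distance at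
most `d`. -/
lemma hausdorffEDist_le_of_forall_norm_sub_le {E : Type*} [SeminormedAddCommGroup E] {T U : Set E}
    {d : ℝ} (hT : T.Nonempty) (hU : U.Nonempty) (h : ∀ a ∈ T, ∀ b ∈ U, ‖a - b‖ ≤ d) :
    Metric.hausdorffEDist T U ≤ ENNReal.ofReal d := by
  obtain ⟨a₀, ha₀⟩ := hT
  obtain ⟨b₀, hb₀⟩ := hU
  have hd : 0 ≤ d := (norm_nonneg _).trans (h a₀ ha₀ b₀ hb₀)
  have hdist : ∀ a ∈ T, ∀ b ∈ U, edist a b ≤ ENNReal.ofReal d := fun a ha b hb => by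
    rw [edist_le_ofReal hd, dist_eq_norm]
    exact h a ha b hb
  refine Metric.hausdorffEDist_le_of_mem_edist (fun a ha => ⟨b₀, hb₀, hdist a ha b₀ hb₀⟩)
    fun b hb => ⟨a₀, ha₀, ?_⟩
  rw [edist_comm]
  exact hdist a₀ ha₀ b hb

/-! ### The unobservable subspace -/

section Observability

variable {n m no nu : ℕ} {A : Matrix (Fin n) (Fin n) ℝ} {C : Matrix (Fin m) (Fin n) ℝ}
  {hn : no + nu = n} {P : Matrix (Fin n) (Fin n) ℝ}

lemma obsPart_sub (x y : Euc n) :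
    obsPart hn P (x - y) = obsPart hn P x - obsPart hn P y := by
  ext i
  simp [obsPart, mulE_sub]

lemma obsPart_eq_zero_iff {x : Euc n} :
    obsPart hn P x = 0 ↔ ∀ i, mulE P x (splitIndex hn (Sum.inl i)) = 0 := by
  simp [obsPart, funext_iff]

lemma mulE_apply_split (M : Matrix (Fin m) (Fin n) ℝ) (x : Euc n) (i : Fin m) :
    mulE M x i = ∑ j, M i (splitIndex hn (Sum.inl j)) * x (splitIndex hn (Sum.inl j)) +
      ∑ j, M i (splitIndex hn (Sum.inr j)) * x (splitIndex hn (Sum.inr j)) := by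
  rw [← Fintype.sum_sum_type fun j => M i (splitIndex hn j) * x (splitIndex hn j)]
  exact ((splitIndex hn).sum_comp fun j => M i j * x j).symm

/-- The kernel of the observable part lies in the kernel of the measurement matrix. -/
lemma IsObservabilityDecomposition.mulE_meas_eq_zero
    (hP : IsObservabilityDecomposition A C hn P) {x : Euc n} (hx : obsPart hn P x = 0) :
    mulE C x = 0 := by
  obtain ⟨hdet, Ao, A21, Au, Co, -, hC, -⟩ := hP
  have hCP : mulE C x = mulE (C * P⁻¹) (mulE P x) := by
    rw [mulE_mulE, Matrix.mul_assoc, Matrix.nonsing_inv_mul _ hdet, Matrix.mul_one]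
  ext i
  rw [hCP, mulE_apply_split (hn := hn)]
  have h (j : Fin nu) : (C * P⁻¹) i (splitIndex hn (Sum.inr j)) = 0 :=
    congrFun (congrFun hC i) (Sum.inr j)
  simp [obsPart_eq_zero_iff.1 hx, h]

/-- The kernel of the observable part is invariant under the state matrix. -/
lemma IsObservabilityDecomposition.obsPart_mulE_eq_zero
    (hP : IsObservabilityDecomposition A C hn P) {x : Euc n} (hx : obsPart hn P x = 0) :
    obsPart hn P (mulE A x) = 0 := by
  obtain ⟨hdet, Ao, A21, Au, Co, hA, -, -⟩ := hP
  have hAP : mulE P (mulE A x) = mulE (P * A * P⁻¹) (mulE P x) := by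
    rw [mulE_mulE, mulE_mulE, Matrix.mul_assoc (P * A), Matrix.nonsing_inv_mul _ hdet,
      Matrix.mul_one]
  refine obsPart_eq_zero_iff.2 fun i => ?_
  rw [hAP, mulE_apply_split (hn := hn)]
  have h (j : Fin nu) :
      (P * A * P⁻¹) (splitIndex hn (Sum.inl i)) (splitIndex hn (Sum.inr j)) = 0 :=
    congrFun (congrFun hA (Sum.inl i)) (Sum.inr j)
  simp [obsPart_eq_zero_iff.1 hx, h]

end Observability

/-! ### Points of the estimates and the error dynamics -/

namespace UncertainSystem

variable {Ω : Type*} {n p m no nu : ℕ} {S : UncertainSystem Ω n p m} {y : ℕ → Euc m}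

lemma IsObserved.exists_meas_eq (hy : S.IsObserved y) (k : ℕ) :
    ∃ ω, ∀ i ≤ k, S.meas i ω = y i := by
  obtain ⟨ω, hω⟩ := hy k
  exact ⟨ω, fun i hi => congrFun hω ⟨i, Nat.lt_succ_of_le hi⟩⟩

lemma mem_trueRange_iff {k : ℕ} {x : Euc n} :
    x ∈ S.trueRange y k ↔ ∃ ω, (∀ i ≤ k, S.meas i ω = y i) ∧ S.state k ω = x := by
  refine exists_congr fun ω => and_congr_left fun _ => ⟨fun h i hi => ?_, fun h => ?_⟩
  · exact congrFun h ⟨i, Nat.lt_succ_of_le hi⟩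
  · exact funext fun i => h i (Nat.le_of_lt_succ i.2)

/-- If the observable part of the initial state is that of a point of the initial condition, then
the estimates contain a point whose observable part is that of the state. -/
lemma exists_mem_classicalSMF_of_obsPart {Xhat0 : Set (Euc n)} {hn : no + nu = n}
    {P : Matrix (Fin n) (Fin n) ℝ} (hP : IsObservabilityDecomposition S.A S.C hn P) {ω : Ω}
    (hω : obsPart hn P (S.x0 ω) ∈ obsPart hn P '' Xhat0) {k : ℕ}
    (hy : ∀ i ≤ k, S.meas i ω = y i) :
    ∃ z ∈ S.classicalSMF Xhat0 y k, obsPart hn P (z - S.state k ω) = 0 := by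
  -- Two states that differ in the unobservable subspace have the same noiseless output, so the
  -- actual noise `v_i(ω)` is a witness for `z` too.
  have hsol {i : ℕ} (hi : S.meas i ω = y i) {z : Euc n}
      (hz : obsPart hn P (z - S.state i ω) = 0) :
      z ∈ solutionSet S.C (y i) (ucRange (S.v i)) := by
    refine ⟨S.v i ω, ⟨ω, rfl⟩, ?_⟩
    have h := hP.mulE_meas_eq_zero hz
    rw [mulE_sub, sub_eq_zero] at h
    rw [← hi, meas, h]
  induction k with
  | zero =>
    obtain ⟨z, hz, hzω⟩ := hω
    have h : obsPart hn P (z - S.state 0 ω) = 0 := by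
      rw [obsPart_sub, sub_eq_zero]
      exact hzω
    exact ⟨z, ⟨hsol (hy 0 le_rfl) h, hz⟩, h⟩
  | succ k ih =>
    obtain ⟨z, hz, hzω⟩ := ih fun i hi => hy i (hi.trans k.le_succ)
    -- The point is propagated with the actual noise `w_k(ω)`, which cancels in the difference.
    have h : obsPart hn P (mulE S.A z + mulE S.B (S.w k ω) - S.state (k + 1) ω) = 0 := by
      rw [state, add_sub_add_right_eq_sub, ← mulE_sub]
      exact hP.obsPart_mulE_eq_zero hzω
    exact ⟨_, ⟨hsol (hy _ le_rfl) h,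
      Set.add_mem_add (Set.mem_image_of_mem _ hz) (Set.mem_image_of_mem _ ⟨ω, rfl⟩)⟩, h⟩

open scoped Matrix.Norms.L2Operator in
/-- The error between a point of the estimate and a state that is consistent with the measurements
is the response of `A - L C` to a bounded initial error and bounded inputs. -/
lemma exists_error_eq_response (L : Matrix (Fin n) (Fin m) ℝ) {Xhat0 : Set (Euc n)}
    {R dw dv : ℝ} (hR : ∀ z ∈ Xhat0, ∀ ω, ‖z - S.x0 ω‖ ≤ R)
    (hw : ∀ k, ∀ a ∈ ucRange (S.w k), ∀ b ∈ ucRange (S.w k), ‖a - b‖ ≤ dw)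
    (hv : ∀ k, ∀ a ∈ ucRange (S.v k), ∀ b ∈ ucRange (S.v k), ‖a - b‖ ≤ dv)
    {ω : Ω} {k : ℕ} (hy : ∀ i ≤ k, S.meas i ω = y i) {z : Euc n}
    (hz : z ∈ S.classicalSMF Xhat0 y k) :
    ∃ (e : Euc n) (u : ℕ → Euc n), ‖e‖ ≤ R ∧ (∀ i, ‖u i‖ ≤ ‖S.B‖ * dw + ‖L‖ * dv) ∧
      z - S.state k ω = mulE ((S.A - L * S.C) ^ k) e +
        ∑ i ∈ Finset.range k, mulE ((S.A - L * S.C) ^ i) (u i) := by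
  have hdw : 0 ≤ dw := (norm_nonneg _).trans (hw 0 _ ⟨ω, rfl⟩ _ ⟨ω, rfl⟩)
  have hdv : 0 ≤ dv := (norm_nonneg _).trans (hv 0 _ ⟨ω, rfl⟩ _ ⟨ω, rfl⟩)
  induction k generalizing z with
  | zero =>
    refine ⟨z - S.x0 ω, 0, hR z hz.2 ω, fun _ => ?_, by simp [one_mulE, state]⟩
    simp only [Pi.zero_apply, norm_zero]
    positivity
  | succ k ih =>
    -- The newest measurement is dropped: the output injection from time `k` to `k + 1` uses `y k`,
    -- with which the predecessor `z'` is consistent.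
    obtain ⟨-, _, ⟨z', hz', rfl⟩, _, ⟨b, hb, rfl⟩, rfl⟩ := hz
    obtain ⟨e, u, he, hu, heq⟩ := ih (fun i hi => hy i (hi.trans k.le_succ)) hz'
    obtain ⟨v', hv', hyv⟩ : z' ∈ solutionSet S.C (y k) (ucRange (S.v k)) := by
      cases k <;> exact hz'.1
    have hC : mulE S.C (z' - S.state k ω) = S.v k ω - v' := by
      have h := hyv.symm.trans (hy k k.le_succ).symm
      rw [meas] at h
      rw [mulE_sub, sub_eq_sub_iff_add_eq_add, h, add_comm]
    have herr : mulE S.A z' + mulE S.B b - S.state (k + 1) ω =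
        mulE (S.A - L * S.C) (z' - S.state k ω) +
          (mulE S.B (b - S.w k ω) + mulE L (S.v k ω - v')) := by
      rw [sub_mulE, ← mulE_mulE, hC, mulE_sub S.A, mulE_sub S.B,
        show S.state (k + 1) ω = mulE S.A (S.state k ω) + mulE S.B (S.w k ω) from rfl]
      abel
    -- Inputs are indexed by age, since `u i` is weighted by the `i`-th power: the new input enters
    -- at index `0` and the older ones shift by one.
    refine ⟨e, fun i => Nat.casesOn i (mulE S.B (b - S.w k ω) + mulE L (S.v k ω - v')) u, he,
      ?_, ?_⟩
    · rintro (_ | i)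
      · refine norm_add_le_of_le ((norm_mulE_le _ _).trans ?_) ((norm_mulE_le _ _).trans ?_)
        · exact mul_le_mul_of_nonneg_left (hw k _ hb _ ⟨ω, rfl⟩) (norm_nonneg _)
        · exact mul_le_mul_of_nonneg_left (hv k _ ⟨ω, rfl⟩ _ hv') (norm_nonneg _)
      · exact hu i
    · change mulE S.A z' + mulE S.B b - S.state (k + 1) ω = _
      rw [herr, heq, Finset.sum_range_succ', mulE_add, mulE_sum]
      simp only [mulE_mulE, ← pow_succ', pow_zero, one_mulE, add_assoc]
      rfl

end UncertainSystem

theorem theorem2 {Ω : Type*} [Nonempty Ω] {n p m no nu : ℕ} (S : UncertainSystem Ω n p m)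
    (hA : IsUnit S.A.det)
    (hx0 : Bornology.IsBounded (ucRange S.x0))
    (hw : ∃ dw : ℝ, 0 < dw ∧ ∀ k, Metric.ediam (ucRange (S.w k)) ≤ ENNReal.ofReal dw)
    (hv : ∃ dv : ℝ, 0 < dv ∧ ∀ k, Metric.ediam (ucRange (S.v k)) ≤ ENNReal.ofReal dv)
    (hunrel : S.Unrelated)
    (Xhat0 : Set (Euc n)) (hXhat0 : Bornology.IsBounded Xhat0)
    (hn : no + nu = n) (P : Matrix (Fin n) (Fin n) ℝ)
    (hP : IsObservabilityDecomposition S.A S.C hn P)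
    (hobs : obsPart hn P '' ucRange S.x0 ⊆ obsPart hn P '' Xhat0)
    (hdet : DetectablePair S.A S.C) :
    S.StableFilter (S.classicalSMF Xhat0) := by
  open scoped Matrix.Norms.L2Operator in
  have hwp : S.WellPosed (S.classicalSMF Xhat0) := fun y hy k => by
    obtain ⟨ω, hω⟩ := hy.exists_meas_eq k
    obtain ⟨z, hz, -⟩ := UncertainSystem.exists_mem_classicalSMF_of_obsPart hP
      (hobs ⟨_, ⟨ω, rfl⟩, rfl⟩) hω
    exact ⟨z, hz⟩
  refine ⟨hwp, ?_⟩
  obtain ⟨dw, hdw, hw⟩ := hw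
  obtain ⟨dv, hdv, hv⟩ := hv
  obtain ⟨L, hL⟩ := hdet
  obtain ⟨r₁, hr₁, h₁⟩ := hXhat0.exists_pos_norm_le
  obtain ⟨r₂, hr₂, h₂⟩ := hx0.exists_pos_norm_le
  -- The bound is fixed before `y` and `k` are introduced, whence its uniformity; `r₁ + r₂` bounds
  -- the initial error.
  obtain ⟨d, hd, hresp⟩ := exists_norm_response_le (S.A - L * S.C) hL (R := r₁ + r₂)
    (D := ‖S.B‖ * dw + ‖L‖ * dv) (by positivity) (by positivity)
  -- Well-posedness is needed here as well: the Hausdorff distance from the empty set to a nonempty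
  -- set is infinite.
  refine ⟨d, hd, fun y hy k => hausdorffEDist_le_of_forall_norm_sub_le (hwp y hy k) ?_ ?_⟩
  · obtain ⟨ω, hω⟩ := hy.exists_meas_eq k
    exact ⟨_, UncertainSystem.mem_trueRange_iff.2 ⟨ω, hω, rfl⟩⟩
  · intro z hz x hx
    obtain ⟨ω, hω, rfl⟩ := UncertainSystem.mem_trueRange_iff.1 hx
    obtain ⟨e, u, he, hu, heq⟩ := UncertainSystem.exists_error_eq_response L
      (fun z hz ω => norm_sub_le_of_le (h₁ z hz) (h₂ _ ⟨ω, rfl⟩))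
      (fun k a ha b hb => norm_sub_le_of_ediam_le hdw.le (hw k) ha hb)
      (fun k a ha b hb => norm_sub_le_of_ediam_le hdv.le (hv k) ha hb) hω hz
    rw [heq]
    exact hresp k e u he hu
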